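/- **Setting.** Let $X\subset\mathbb R^n$, $U\subset\mathbb R^m$ be compact, $x_0\in X$, $T\ge 0$, $f$ a vector field, $\ell,g\ge 0$ running and terminal costs on $X\times U$, and $\phi=(\phi_1,\dots,\phi_N)$ basis functions. For $w\in W\subset\mathbb R^N$ let $\langle w,\phi\rangle=\sum_i w_i\phi_i$, and assume that it is a feedback policy $X\to U$, that the closed-loop system $\dot x=f(x,\langle w,\phi(x)\rangle)$, $x(0)=x_0$, has a unique solution on $[0,T]$ staying in $X$, and that the running cost along it is integrable. With $u(t)=\langle w,\phi(x(t))\rangle$ put $J(w)=\int_0^T\ell(x(t),u(t))\,dt+g(x(T),u(T))$. Assume that $J$ is measurable on $W$, and let $w^*\in W$ be an optimal weight vector: $J(w^*)\le J(w)$ for all $w\in W$. Put $H=-J$. Let $S$ be strictly decreasing and positive on $J(W)$. Let $\Theta$ be a set of parameters $\theta=(\mu,\Sigma)$, $\mu\in\mathbb R^N$, $\Sigma\in\mathbb R^{N\times N}$ symmetric positive definite, with $\theta_0\in\Theta$. Let $p(w,\theta)=((2\pi)^N|\Sigma|)^{-1/2}\exp(-\tfrac12(w-\mu)^\top\Sigma^{-1}(w-\mu))$.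 Sampling from $p(\cdot,\theta)$ means sampling from this Gaussian conditioned on $W$, and $\mathbb E_\theta$ is the corresponding expectation. Write $\lceil a\rceil$ for the smallest integer strictly greater than $a$. **Planner.** Parameters: $\rho\in(0,1]$, $\varepsilon\ge0$, $\alpha\ge 0$, an initial sample size $N_1\ge1$, $\lambda\in[0,1)$. Start with $\theta_1=\theta_0$, $\rho_1=\rho$. In iteration $k=1,2,\dots$, given the past, draw $N_k$ i.i.d. samples from $p(\cdot,\theta_k)$ and order their costs as $J_{k,(1)}\ge\dots\ge J_{k,(N_k)}$. For $r\in(0,1]$ let $\kappa_k(r)=J_{k,(\lceil(1-r)N_k\rceil)}$. 1. *Threshold.* If $k=1$, or if $k\ge2$ and $\kappa_k(\rho_k)\le\gamma_{k-1}-\varepsilon$, put $\gamma_k=\kappa_k(\rho_k)$, $\rho_{k+1}=\rho_k$, $N_{k+1}=N_k$. Otherwise, if some $r\in(0,1]$ satisfies $\kappa_k(r)\le\gamma_{k-1}-\varepsilon$, let $\rho_{k+1}$ be the largest such $r$, $\gamma_k=\kappa_k(\rho_{k+1})$, $N_{k+1}=N_k$. Otherwise the iteration is *stalled*: $\gamma_k=\gamma_{k-1}$,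 $\rho_{k+1}=\rho_k$, $N_{k+1}=\lceil(1+\alpha)N_k\rceil$. 2. *Parameter update.* Choose $$\theta^*_{k+1}\in\arg\max_{\theta\in\Theta}\ \mathbb E_{\theta_k}\Big[\frac{S(J(w))^k}{p(w,\theta_k)}\,\mathbf 1_{\{J(w)\le\gamma_k\}}\ln p(w,\theta)\Big],\qquad \theta_{k+1}=\lambda\theta_k+(1-\lambda)\theta^*_{k+1}.$$ In a stalled iteration one of two rules, fixed in advance, is followed: either (update rule) the parameter update is performed with the unchanged threshold, or (hold rule) it is skipped and $\theta_{k+1}=\theta_k$. The hold rule is allowed only if $\varepsilon=0$. **Lemma.** Assume that $W$ is compact and that 1. for every $\xi<H(w^*)$ the set $\{w\in W: H(w)\ge\xi\}$ has positive Lebesgue measure; 2. for every $\delta>0$, $\sup\{H(w): w\in W,\ \|w-w^*\|\ge\delta\}<H(w^*)$, where $\sup\emptyset=-\infty$; 3. almost surely, in each iteration $k$ that performs the parameter update, $\theta^*_{k+1}$ is an interior point of $\Theta$ (relative to the space of pairs $(\mu,\Sigma)$ with $\Sigma$ symmetric). Then, with probability one, the parameters $\theta_k=(\mu_k,\Sigma_k)$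 satisfy $\lim_{k\to\infty}\mu_k=w^*$ and $\lim_{k\to\infty}\Sigma_k=0_{N\times N}$. -/

import Mathlib

open MeasureTheory ProbabilityTheory Filter Topology Set
open scoped ENNReal Matrix

noncomputable section

namespace MRASPlanner

/-- Vectors with the Euclidean norm and Lebesgue measure. -/
abbrev Vec (n : ℕ) := EuclideanSpace ℝ (Fin n)

/-- The deterministic finite-horizon optimal control problem
`min ∫₀ᵀ ℓ(x,u) dt + g(x(T),u(T))` subject to `ẋ = f(x,u)`, `x ∈ X`, `u ∈ U`, `x(0) = x₀`. -/
structure ControlProblem (n m : ℕ) where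
  X : Set (Vec n)
  U : Set (Vec m)
  f : Vec n → Vec m → Vec n
  x₀ : Vec n
  T : ℝ
  runCost : Vec n → Vec m → ℝ
  endCost : Vec n → Vec m → ℝ
  isCompact_X : IsCompact X
  isCompact_U : IsCompact U
  x₀_mem : x₀ ∈ X
  T_nonneg : 0 ≤ T
  runCost_nonneg : ∀ x ∈ X, ∀ u ∈ U, 0 ≤ runCost x u
  endCost_nonneg : ∀ x ∈ X, ∀ u ∈ U, 0 ≤ endCost x u

namespace ControlProblem

variable {n m N : ℕ} (P : ControlProblem n m)

/-- The feedback policies `u : X → U`. -/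
def policies : Set (Vec n → Vec m) := {u | MapsTo u P.X P.U}

/-- `x` solves the closed-loop system `ẋ = f(x, u(x))`, `x(0) = x₀`, on `[0,T]` inside `X`,
in integral form (so that the feedback `u` may be discontinuous). -/
def IsTrajectory (u : Vec n → Vec m) (x : ℝ → Vec n) : Prop :=
  (∀ t ∈ Icc 0 P.T, x t ∈ P.X) ∧
  IntervalIntegrable (fun s => P.f (x s) (u (x s))) volume 0 P.T ∧
  ∀ t ∈ Icc 0 P.T, x t = P.x₀ + ∫ s in (0 : ℝ)..t, P.f (x s) (u (x s))

/-- The closed-loop system has a unique solution on `[0,T]`, and its running cost is integrable. -/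
def WellPosed (u : Vec n → Vec m) : Prop :=
  ∃ x, P.IsTrajectory u x ∧
    (∀ y, P.IsTrajectory u y → EqOn y x (Icc 0 P.T)) ∧
    IntervalIntegrable (fun t => P.runCost (x t) (u (x t))) volume 0 P.T

open Classical in
/-- The closed-loop trajectory under `u`. -/
def trajectory (u : Vec n → Vec m) : ℝ → Vec n :=
  if h : ∃ x, P.IsTrajectory u x then h.choose else fun _ => P.x₀

/-- The cost `J(x₀, u)`. -/
def cost (u : Vec n → Vec m) : ℝ :=
  (∫ t in (0 : ℝ)..P.T, P.runCost (P.trajectory u t) (u (P.trajectory u t))) +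
    P.endCost (P.trajectory u P.T) (u (P.trajectory u P.T))

/-- The policy function approximation `⟨w, φ⟩ = ∑ᵢ wᵢ φᵢ`. -/
def policy (φ : Fin N → Vec n → Vec m) (w : Vec N) : Vec n → Vec m :=
  fun x => ∑ i, w i • φ i x

/-- `J(x₀; w) = J(x₀, ⟨w, φ⟩)`. -/
def weightCost (φ : Fin N → Vec n → Vec m) (w : Vec N) : ℝ := P.cost (policy φ w)

/-- `w` is an optimal weight vector in the weight domain `W`, with respect to `φ`. -/
def IsOptimalWeight (φ : Fin N → Vec n → Vec m) (W : Set (Vec N)) (w : Vec N) : Prop :=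
  w ∈ W ∧ policy φ w ∈ P.policies ∧
    ∀ v ∈ W, policy φ v ∈ P.policies → P.weightCost φ w ≤ P.weightCost φ v

end ControlProblem

/-- The parameters `θ = (μ, Σ)` with `Σ` a symmetric matrix. Interiors of sets of parameters are
taken in this space. -/
abbrev Param (N : ℕ) := Vec N × selfAdjoint (Matrix (Fin N) (Fin N) ℝ)

/-- The mean vector `μ`. -/
def mean {N : ℕ} (θ : Param N) : Vec N := θ.1

/-- The covariance matrix `Σ`. -/
def covMatrix {N : ℕ} (θ : Param N) : Matrix (Fin N) (Fin N) ℝ := θ.2.1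

/-- The Gaussian density `p(w; θ)`. -/
def density {N : ℕ} (θ : Param N) (w : Vec N) : ℝ :=
  (√((2 * Real.pi) ^ N * (covMatrix θ).det))⁻¹ *
    Real.exp (-(1 / 2) *
      ((w - mean θ).ofLp ⬝ᵥ ((covMatrix θ)⁻¹ *ᵥ (w - mean θ).ofLp)))

/-- The Gaussian distribution `p(·; θ)` supported on `W`, i.e. conditioned to lie in `W`. -/
def samplingLaw {N : ℕ} (W : Set (Vec N)) (θ : Param N) : Measure (Vec N) :=
  cond (volume.withDensity fun w => ENNReal.ofReal (density θ w)) W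

/-- The smallest integer that is greater than `a` (for `a ≥ 0`). -/
def nextInt (a : ℝ) : ℕ := ⌊a⌋₊ + 1

/-- The estimated `(1-r)`-quantile of the costs `c 0, …, c (M-1)`: with the costs ordered as
`J₍₁₎ ≥ … ≥ J₍M₎`, it is `J₍ⱼ₎` for `j = nextInt ((1-r) M)`, which is in `{1, …, M}` for
`0 < r ≤ 1 ≤ M`. -/
def sampleQuantile (c : ℕ → ℝ) (M : ℕ) (r : ℝ) : ℝ :=
  (((Multiset.range M).map c).sort (· ≥ ·)).getD (nextInt ((1 - r) * M) - 1) 0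

/-- What the planner does in an iteration in which the sampled costs admit no improvement of the
threshold: perform the parameter update with the unchanged threshold, or leave `θ` unchanged. -/
inductive StallRule
  | update
  | hold

/-- The tuning parameters of the planner: quantile level `ρ`, improvement parameter `ε`, sample
increment percentage `α`, initial sample size `N₁`, smoothing coefficient `lam`. -/
structure Tuning where
  ρ : ℝ
  ε : ℝ
  α : ℝ
  N₁ : ℕ
  lam : ℝ
  stall : StallRule
  ρ_pos : 0 < ρ
  ρ_le_one : ρ ≤ 1
  ε_nonneg : 0 ≤ ε
  α_nonneg : 0 ≤ α
  N₁_pos : 1 ≤ N₁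
  lam_nonneg : 0 ≤ lam
  lam_lt_one : lam < 1

open Classical in
/-- The objective of the parameter update in iteration `k`,
`θ ↦ 𝔼_{θₖ}[ S(J(w))ᵏ / p(w,θₖ) · 𝟙{J(w) ≤ γ} · ln p(w,θ) ]`. -/
def updateObjective {N : ℕ} (J : Vec N → ℝ) (S : ℝ → ℝ) (W : Set (Vec N))
    (k : ℕ) (γ : ℝ) (θk θ : Param N) : ℝ :=
  ∫ w, S (J w) ^ k / density θk w * (if J w ≤ γ then 1 else 0) * Real.log (density θ w)
    ∂(samplingLaw W θk)

/-- The random quantities produced by the planner. Iterations are numbered `k = 1, 2, …`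
(index `0` is not used). -/
structure PlannerRun (Ω : Type*) (N : ℕ) where
  /-- `θₖ`, the parameter that iteration `k` samples from. -/
  θ : ℕ → Ω → Param N
  /-- `θ*ₖ₊₁` (at index `k + 1`), the maximizer found in iteration `k`. -/
  θopt : ℕ → Ω → Param N
  /-- The threshold at the end of the threshold selection of iteration `k`. -/
  γ : ℕ → Ω → ℝ
  /-- The quantile level at the start of iteration `k`. -/
  ρ : ℕ → Ω → ℝ
  /-- The sample size `Nₖ`. -/
  size : ℕ → Ω → ℕ
  /-- The samples of iteration `k`; those with index `< Nₖ` are the ones used. -/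
  sample : ℕ → ℕ → Ω → Vec N

namespace PlannerRun

variable {Ω : Type*} {N : ℕ} (R : PlannerRun Ω N) (J : Vec N → ℝ) (τ : Tuning)

/-- The estimated `(1-r)`-quantile of the costs of the samples of iteration `k`. -/
def quantile (k : ℕ) (ω : Ω) (r : ℝ) : ℝ :=
  sampleQuantile (fun i => J (R.sample k i ω)) (R.size k ω) r

/-- The levels whose estimated quantile in iteration `k` improves the previous threshold by at
least `ε`. -/
def improvingLevels (k : ℕ) (ω : Ω) : Set ℝ :=
  {r | 0 < r ∧ r ≤ 1 ∧ R.quantile J k ω r ≤ R.γ (k - 1) ω - τ.ε}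

/-- Iteration `k` admits no improvement of the threshold. -/
def Stalled (k : ℕ) (ω : Ω) : Prop := 2 ≤ k ∧ ¬ (R.improvingLevels J τ k ω).Nonempty

/-- Iteration `k` performs the parameter update. -/
def Updates (k : ℕ) (ω : Ω) : Prop :=
  ¬ R.Stalled J τ k ω ∨ τ.stall = StallRule.update

/-- The choice of the threshold, the quantile level and the sample size in iteration `k`. -/
def ThresholdStep (k : ℕ) (ω : Ω) : Prop :=
  let κ := R.quantile J k ω (R.ρ k ω)
  -- first iteration
  (k = 1 → R.γ k ω = κ ∧ R.ρ (k + 1) ω = R.ρ k ω ∧ R.size (k + 1) ω = R.size k ω) ∧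
  -- the current quantile improves the threshold
  (2 ≤ k → κ ≤ R.γ (k - 1) ω - τ.ε →
    R.γ k ω = κ ∧ R.ρ (k + 1) ω = R.ρ k ω ∧ R.size (k + 1) ω = R.size k ω) ∧
  -- it does not, but the quantile at some other level does: take the largest such level
  (2 ≤ k → R.γ (k - 1) ω - τ.ε < κ → (R.improvingLevels J τ k ω).Nonempty →
    IsGreatest (R.improvingLevels J τ k ω) (R.ρ (k + 1) ω) ∧
      R.γ k ω = R.quantile J k ω (R.ρ (k + 1) ω) ∧ R.size (k + 1) ω = R.size k ω) ∧
  -- no level does: keep the threshold, increase the sample size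
  (R.Stalled J τ k ω →
    R.γ k ω = R.γ (k - 1) ω ∧ R.ρ (k + 1) ω = R.ρ k ω ∧
      R.size (k + 1) ω = nextInt ((1 + τ.α) * R.size k ω))

/-- The parameter update of iteration `k`, with smoothing. -/
def ParameterStep (S : ℝ → ℝ) (W : Set (Vec N)) (Θ : Set (Param N)) (k : ℕ) (ω : Ω) : Prop :=
  (R.Updates J τ k ω →
    (R.θopt (k + 1) ω ∈ Θ ∧
      IsMaxOn (updateObjective J S W k (R.γ k ω) (R.θ k ω)) Θ (R.θopt (k + 1) ω)) ∧
    R.θ (k + 1) ω = τ.lam • R.θ k ω + (1 - τ.lam) • R.θopt (k + 1) ω) ∧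
  (¬ R.Updates J τ k ω → R.θ (k + 1) ω = R.θ k ω)

/-- `R` is a run of the planner on `(Ω, Pr)`. The σ-algebra `ℱ k` is the history before the sampling
of iteration `k`. -/
structure IsRun [MeasurableSpace Ω] (Pr : Measure Ω) (ℱ : Filtration ℕ ‹MeasurableSpace Ω›)
    (S : ℝ → ℝ) (W : Set (Vec N)) (Θ : Set (Param N)) (θ₀ : Param N) : Prop where
  init : ∀ᵐ ω ∂Pr, R.θ 1 ω = θ₀ ∧ R.ρ 1 ω = τ.ρ ∧ R.size 1 ω = τ.N₁
  θ_meas : ∀ k, 1 ≤ k → StronglyMeasurable[ℱ k] (R.θ k)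
  ρ_meas : ∀ k, 1 ≤ k → Measurable[ℱ k] (R.ρ k)
  size_meas : ∀ k, 1 ≤ k → Measurable[ℱ k] (R.size k)
  sample_meas : ∀ k, 1 ≤ k → ∀ i, Measurable[ℱ (k + 1)] (R.sample k i)
  γ_meas : ∀ k, 1 ≤ k → Measurable[ℱ (k + 1)] (R.γ k)
  /-- Given the history, the samples of iteration `k` are i.i.d. with law `p(·; θₖ)` on `W`. -/
  sampling : ∀ k, 1 ≤ k → ∀ A : Set Ω, MeasurableSet[ℱ k] A → ∀ (M : ℕ) (B : ℕ → Set (Vec N)),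
    (∀ i, MeasurableSet (B i)) →
    Pr (A ∩ ⋂ i ∈ Finset.range M, R.sample k i ⁻¹' B i) =
      ∫⁻ ω in A, ∏ i ∈ Finset.range M, samplingLaw W (R.θ k ω) (B i) ∂Pr
  threshold : ∀ᵐ ω ∂Pr, ∀ k, 1 ≤ k → R.ThresholdStep J τ k ω
  parameter : ∀ᵐ ω ∂Pr, ∀ k, 1 ≤ k → R.ParameterStep J τ S W Θ k ω

end PlannerRun

end MRASPlanner

end

/-! Dividing by `density θk` cancels the sampling density, so up to a positive factor the update
maximizes the expected log-likelihood under a target measure on `W` with density `S(J)^k 𝟙{J ≤ γ_k}`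
(`exists_updateObjective_eq`). Past samples enter only through `γ_k`. An interior maximizer matches
the first two moments of that measure (`moments_of_isMaxOn`), hence its second moments about `wstar`
(`second_moment_update_eq`).

The target measures concentrate at `wstar`: far from it `S(J)` stays below a value that it exceeds
on a sublevel set of positive volume, so the relative far mass decays geometrically, uniformly over
`γ > J wstar` (`exists_targetMeasure_far_le`). Thus variance plus squared bias of the maximizers
tends to zero along updating iterations, and smoothing passes this on to `θ_k`
(`tendsto_zero_of_smoothing`).

Probability enters twice. Every threshold is the cost of a sample and `{J ≤ J wstar}` is null in
`W`, so almost surely `γ_k > J wstar` (`ae_threshold_gt`); convergence of `γ_k` is not needed. And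
updates never cease: under the hold rule, eternal stalling would freeze both `θ` and `γ`, while
fresh samples from a fixed law almost surely hit a sublevel set below `γ`
(`measure_frozen_and_missed`, `ae_frequently_updates`). -/

namespace MRASPlanner

/-! ### Smoothing recursions and sample quantiles -/

/-- Exponential smoothing, performed infinitely often, of inputs that tend to zero. -/
theorem tendsto_zero_of_smoothing {a b : ℕ → ℝ} {U : Set ℕ} {lam : ℝ} (h0 : 0 ≤ lam)
    (h1 : lam < 1) (hU : ∃ᶠ k in atTop, k ∈ U)
    (hup : ∀ᶠ k in atTop, k ∈ U → a (k + 1) = lam * a k + (1 - lam) * b k)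
    (hhold : ∀ᶠ k in atTop, k ∉ U → a (k + 1) = a k)
    (hb : Tendsto b (atTop ⊓ 𝓟 U) (𝓝 0)) : Tendsto a atTop (𝓝 0) := by
  rw [Metric.tendsto_atTop]
  intro ε hε
  have hb' : ∀ᶠ k in atTop, k ∈ U → |b k| < ε / 2 := by
    have := (Metric.tendsto_nhds.1 hb) (ε / 2) (by positivity)
    rw [eventually_inf_principal] at this
    simpa [Real.dist_eq] using this
  obtain ⟨K, hK⟩ := eventually_atTop.1 (hup.and (hhold.and hb'))
  -- The excess of `|a|` over `ε / 2` contracts by `lam` at updates and is constant otherwise. It is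
  -- therefore antitone, and its limit satisfies `L ≤ lam * L` because contraction recurs infinitely
  -- often.
  set c : ℕ → ℝ := fun j => max (|a (K + j)| - ε / 2) 0 with hc
  have hcU : ∀ j, K + j ∈ U → c (j + 1) ≤ lam * c j := by
    intro j hj
    obtain ⟨h2, -, h3⟩ := hK (K + j) (by omega)
    have h4 : |a (K + j + 1)| ≤ lam * |a (K + j)| + (1 - lam) * (ε / 2) := by
      rw [h2 hj]
      refine (abs_add_le _ _).trans ?_
      rw [abs_mul, abs_mul, abs_of_nonneg h0, abs_of_nonneg (by linarith : 0 ≤ 1 - lam)]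
      have := mul_le_mul_of_nonneg_left (h3 hj).le (by linarith : 0 ≤ 1 - lam)
      linarith
    have h5 := mul_le_mul_of_nonneg_left (le_max_left (|a (K + j)| - ε / 2) 0) h0
    have h6 := mul_nonneg h0 (le_max_right (|a (K + j)| - ε / 2) 0)
    refine max_le ?_ h6
    rw [← add_assoc]
    linarith
  have hcn : ∀ j, K + j ∉ U → c (j + 1) = c j := by
    intro j hj
    obtain ⟨-, h2, -⟩ := hK (K + j) (by omega)
    simp only [hc, ← add_assoc, h2 hj]
  have hc0 : ∀ j, 0 ≤ c j := fun j => le_max_right _ _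
  have hanti : Antitone c := by
    refine antitone_nat_of_succ_le fun j => ?_
    by_cases hj : K + j ∈ U
    · exact (hcU j hj).trans (mul_le_of_le_one_left (hc0 j) h1.le)
    · exact (hcn j hj).le
  have hlim := tendsto_atTop_ciInf hanti ⟨0, by rintro _ ⟨j, rfl⟩; exact hc0 j⟩
  set L := ⨅ j, c j
  have hfreq : ∃ᶠ j in atTop, c (j + 1) ≤ lam * c j := by
    rw [frequently_atTop] at hU ⊢
    intro j₀
    obtain ⟨k, hk, hkU⟩ := hU (K + j₀)
    obtain ⟨j, rfl⟩ := Nat.exists_eq_add_of_le (show K ≤ k by omega)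
    exact ⟨j, by omega, hcU j hkU⟩
  have hL : L ≤ lam * L :=
    le_of_tendsto_of_tendsto_of_frequently ((tendsto_add_atTop_iff_nat 1).2 hlim)
      (hlim.const_mul lam) hfreq
  have hL0 : L ≤ 0 := by nlinarith
  obtain ⟨j₀, hj₀⟩ := eventually_atTop.1 (hlim.eventually_lt_const
    (show L < ε / 2 by linarith [hε]))
  refine ⟨K + j₀, fun k hk => ?_⟩
  obtain ⟨j, rfl⟩ := Nat.exists_eq_add_of_le (show K ≤ k by omega)
  have := hj₀ j (by omega)
  rw [Real.dist_eq, sub_zero]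
  linarith [le_max_left (|a (K + j)| - ε / 2) 0]

/-- A sample quantile at a positive level is the cost of one of the samples. -/
theorem exists_sampleQuantile_eq (c : ℕ → ℝ) {M : ℕ} (hM : 1 ≤ M) {r : ℝ} (hr : 0 < r) :
    ∃ i < M, sampleQuantile c M r = c i := by
  -- Since `r > 0`, `⌊(1 - r) M⌋₊ < M`, so the default value `0` of `getD` is never returned.
  have hlen : nextInt ((1 - r) * M) - 1 <
      (((Multiset.range M).map c).sort (· ≥ ·)).length := by
    simp only [nextInt, Nat.add_sub_cancel, Multiset.length_sort, Multiset.card_map,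
      Multiset.card_range]
    have : (0 : ℝ) < M := by exact_mod_cast hM
    exact (Nat.floor_lt' (by omega)).2 (by nlinarith)
  have hmem := List.getElem_mem hlen
  rw [Multiset.mem_sort, Multiset.mem_map] at hmem
  obtain ⟨i, hi, h⟩ := hmem
  refine ⟨i, Multiset.mem_range.1 hi, ?_⟩
  rw [sampleQuantile, List.getD_eq_getElem _ _ hlen, h]

/-- The cost of every sample is a sample quantile. -/
theorem exists_eq_sampleQuantile (c : ℕ → ℝ) {M i : ℕ} (hi : i < M) :
    ∃ r, 0 < r ∧ r ≤ 1 ∧ sampleQuantile c M r = c i := by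
  have hmem : c i ∈ ((Multiset.range M).map c).sort (· ≥ ·) := by
    rw [Multiset.mem_sort]
    exact Multiset.mem_map_of_mem c (Multiset.mem_range.2 hi)
  obtain ⟨j, hj, h⟩ := List.getElem_of_mem hmem
  have hjM : j < M := by simpa using hj
  have hM : (0 : ℝ) < M := by exact_mod_cast (by omega : 0 < M)
  -- At this level `(1 - r) M = j` exactly; `nextInt` is strict, so it gives `j + 1`, which is the
  -- zero-based position `j`.
  refine ⟨1 - j / M, ?_, ?_, ?_⟩
  · rw [sub_pos, div_lt_one hM]
    exact_mod_cast hjM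
  · rw [sub_le_self_iff]
    positivity
  · have : nextInt ((1 - (1 - (j : ℝ) / M)) * M) - 1 = j := by
      rw [sub_sub_cancel, div_mul_cancel₀ _ hM.ne', nextInt, Nat.floor_natCast,
        Nat.add_sub_cancel]
    rw [sampleQuantile, this, List.getD_eq_getElem _ _ hj, h]

/-! ### Pathwise properties of the threshold -/

namespace PlannerRun

variable {Ω : Type*} {N : ℕ} {R : PlannerRun Ω N} {J : Vec N → ℝ} {τ : Tuning} {ω : Ω}

theorem level_and_size_of_thresholdStep (hρ : R.ρ 1 ω = τ.ρ) (hN : R.size 1 ω = τ.N₁)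
    (hT : ∀ k, 1 ≤ k → R.ThresholdStep J τ k ω) {k : ℕ} (hk : 1 ≤ k) :
    (0 < R.ρ k ω ∧ R.ρ k ω ≤ 1) ∧ 1 ≤ R.size k ω := by
  induction k, hk using Nat.le_induction with
  | base => exact ⟨⟨hρ ▸ τ.ρ_pos, hρ ▸ τ.ρ_le_one⟩, hN ▸ τ.N₁_pos⟩
  | succ k hk ih =>
    obtain ⟨h1, h2, h3, h4⟩ := hT k hk
    rcases hk.eq_or_lt with rfl | hk2
    · obtain ⟨-, h, h'⟩ := h1 rfl
      rwa [h, h']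
    · by_cases hst : R.Stalled J τ k ω
      · obtain ⟨-, h, h'⟩ := h4 hst
        rw [h, h']
        exact ⟨ih.1, Nat.le_add_left _ _⟩
      · rcases le_or_gt (R.quantile J k ω (R.ρ k ω)) (R.γ (k - 1) ω - τ.ε) with hle | hlt
        · obtain ⟨-, h, h'⟩ := h2 hk2 hle
          rwa [h, h']
        · have hne : (R.improvingLevels J τ k ω).Nonempty := by
            by_contra hne
            exact hst ⟨hk2, hne⟩
          obtain ⟨h, -, h'⟩ := h3 hk2 hlt hne
          rw [h']
          exact ⟨⟨h.1.1, h.1.2.1⟩, ih.2⟩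

/-- The threshold is always the cost of some earlier sample. -/
theorem exists_threshold_eq (hρ : R.ρ 1 ω = τ.ρ) (hN : R.size 1 ω = τ.N₁)
    (hT : ∀ k, 1 ≤ k → R.ThresholdStep J τ k ω) {k : ℕ} (hk : 1 ≤ k) :
    ∃ j i, 1 ≤ j ∧ R.γ k ω = J (R.sample j i ω) := by
  induction k, hk using Nat.le_induction with
  | base =>
    obtain ⟨hr, hs⟩ := level_and_size_of_thresholdStep hρ hN hT le_rfl
    obtain ⟨i, -, hi⟩ := exists_sampleQuantile_eq (fun i => J (R.sample 1 i ω)) hs hr.1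
    exact ⟨1, i, le_rfl, ((hT 1 le_rfl).1 rfl).1.trans hi⟩
  | succ k hk ih =>
    obtain ⟨hr, hs⟩ := level_and_size_of_thresholdStep hρ hN hT (show 1 ≤ k + 1 by omega)
    -- When the level is changed, the threshold is the quantile at the new level, so its positivity
    -- is needed too.
    have hr' := (level_and_size_of_thresholdStep hρ hN hT (show 1 ≤ k + 1 + 1 by omega)).1
    obtain ⟨-, h2, h3, h4⟩ := hT (k + 1) (by omega)
    by_cases hst : R.Stalled J τ (k + 1) ω
    · obtain ⟨j, i, hj, h⟩ := ih
      exact ⟨j, i, hj, (h4 hst).1.trans h⟩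
    · have hne : (R.improvingLevels J τ (k + 1) ω).Nonempty := by
        by_contra hne
        exact hst ⟨by omega, hne⟩
      rcases le_or_gt (R.quantile J (k + 1) ω (R.ρ (k + 1) ω)) (R.γ (k + 1 - 1) ω - τ.ε)
        with hle | hlt
      · obtain ⟨i, -, hi⟩ := exists_sampleQuantile_eq
          (fun i => J (R.sample (k + 1) i ω)) hs hr.1
        exact ⟨k + 1, i, by omega, (h2 (by omega) hle).1.trans hi⟩
      · obtain ⟨i, -, hi⟩ := exists_sampleQuantile_eq
          (fun i => J (R.sample (k + 1) i ω)) hs hr'.1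
        exact ⟨k + 1, i, by omega, (h3 (by omega) hlt hne).2.1.trans hi⟩

/-- In a stalled iteration every sample costs more than the improvement asked for. -/
theorem Stalled.lt_cost {k : ℕ} (h : R.Stalled J τ k ω) {i : ℕ} (hi : i < R.size k ω) :
    R.γ (k - 1) ω - τ.ε < J (R.sample k i ω) := by
  obtain ⟨r, hr0, hr1, hr⟩ := exists_eq_sampleQuantile (fun i => J (R.sample k i ω)) hi
  by_contra! hle
  exact h.2 ⟨r, hr0, hr1, hr.le.trans hle⟩

end PlannerRun

end MRASPlanner

namespace MRASPlanner

/-! ### Gaussian log-densities and moment matching -/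

section Gaussian

variable {N : ℕ}

theorem density_pos {θ : Param N} (h : (covMatrix θ).PosDef) (w : Vec N) : 0 < density θ w := by
  have := h.det_pos
  unfold density
  positivity

theorem log_density {θ : Param N} (h : 0 < (covMatrix θ).det) (w : Vec N) :
    Real.log (density θ w) = -(1 / 2) * Real.log ((2 * Real.pi) ^ N * (covMatrix θ).det) -
      1 / 2 * ((w - mean θ).ofLp ⬝ᵥ ((covMatrix θ)⁻¹ *ᵥ (w - mean θ).ofLp)) := by
  have h2 : 0 < (2 * Real.pi) ^ N * (covMatrix θ).det := by positivity
  rw [density, Real.log_mul (by positivity) (by positivity), Real.log_exp, Real.log_inv,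
    Real.log_sqrt h2.le]
  ring

theorem continuous_density (θ : Param N) : Continuous (density θ) := by
  unfold density
  fun_prop

/-- The parameter direction that moves the mean along `v`. -/
def meanDirection (v : Fin N → ℝ) : Param N := (WithLp.toLp 2 v, 0)

/-- The parameter direction that moves the covariance along `v vᵀ`. -/
def covDirection (v : Fin N → ℝ) : Param N :=
  (0, ⟨Matrix.vecMulVec v v, by
    rw [selfAdjoint.mem_iff]
    ext i j
    simp [Matrix.vecMulVec_apply, Matrix.star_apply, mul_comm]⟩)

theorem mulVec_inv_cancel {A : Matrix (Fin N) (Fin N) ℝ} (hA : A.PosDef) (u : Fin N → ℝ) :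
    A⁻¹ *ᵥ (A *ᵥ u) = u := by
  rw [Matrix.mulVec_mulVec, Matrix.nonsing_inv_mul _ hA.det_pos.ne'.isUnit, Matrix.one_mulVec]

theorem vecMul_mulVec_inv {A : Matrix (Fin N) (Fin N) ℝ} (hA : A.PosDef) (u : Fin N → ℝ) :
    (A *ᵥ u) ᵥ* A⁻¹ = u := by
  have hT : A⁻¹ᵀ = A⁻¹ := by simpa using hA.isHermitian.inv.eq
  rw [← Matrix.mulVec_transpose, hT, mulVec_inv_cancel hA]

/-- Moving the mean along `Σ u` instead of `u` cancels `Σ⁻¹`: the linear term in `t` is the centred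
coordinate along `u`, and the quadratic term does not depend on `w`. -/
theorem log_density_add_meanDirection {θ : Param N} (hθ : (covMatrix θ).PosDef)
    (u : Fin N → ℝ) (t : ℝ) (w : Vec N) :
    Real.log (density (θ + t • meanDirection (covMatrix θ *ᵥ u)) w) =
      Real.log (density θ w) + t * (u ⬝ᵥ (w - mean θ).ofLp) -
        t ^ 2 / 2 * (u ⬝ᵥ covMatrix θ *ᵥ u) := by
  set A := covMatrix θ with hA
  have hcov : covMatrix (θ + t • meanDirection (A *ᵥ u)) = A := by
    simp [covMatrix, meanDirection, hA]
  have hmean : (w - mean (θ + t • meanDirection (A *ᵥ u))).ofLp =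
      (w - mean θ).ofLp - t • (A *ᵥ u) := by
    ext i
    simp [mean, meanDirection, sub_sub]
  rw [log_density (by rw [hcov]; exact hθ.det_pos), log_density hθ.det_pos, hcov, hmean]
  set x := (w - mean θ).ofLp
  simp only [Matrix.mulVec_sub, Matrix.mulVec_smul, mulVec_inv_cancel hθ, sub_dotProduct,
    dotProduct_sub, smul_dotProduct, dotProduct_smul, smul_eq_mul]
  rw [Matrix.dotProduct_mulVec (A *ᵥ u), vecMul_mulVec_inv hθ, dotProduct_comm x u,
    dotProduct_comm (A *ᵥ u) u]
  ring

/-- For a rank-one change along `(Σ u)(Σ u)ᵀ`, the matrix determinant lemma gives `hdet` and the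
Sherman–Morrison formula gives `hinv`; the correction to `Σ⁻¹` is then a multiple of `u uᵀ`. -/
theorem log_density_add_covDirection {θ : Param N} (hθ : (covMatrix θ).PosDef)
    (u : Fin N → ℝ) {t : ℝ} (ht : 0 < 1 + t * (u ⬝ᵥ covMatrix θ *ᵥ u)) (w : Vec N) :
    Real.log (density (θ + t • covDirection (covMatrix θ *ᵥ u)) w) =
      Real.log (density θ w) - 1 / 2 * Real.log (1 + t * (u ⬝ᵥ covMatrix θ *ᵥ u)) +
        1 / 2 * (t / (1 + t * (u ⬝ᵥ covMatrix θ *ᵥ u))) * (u ⬝ᵥ (w - mean θ).ofLp) ^ 2 := by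
  set A := covMatrix θ with hA
  set a := u ⬝ᵥ A *ᵥ u with ha
  have hcov : covMatrix (θ + t • covDirection (A *ᵥ u)) =
      A + t • Matrix.vecMulVec (A *ᵥ u) (A *ᵥ u) := by
    simp [covMatrix, covDirection, hA]
  have hmean : mean (θ + t • covDirection (A *ᵥ u)) = mean θ := by
    simp [mean, covDirection]
  have hdet : (A + t • Matrix.vecMulVec (A *ᵥ u) (A *ᵥ u)).det = A.det * (1 + t * a) := by
    have := Matrix.det_add_replicateCol_mul_replicateRow (ι := Unit) hθ.det_pos.ne'.isUnit
      (t • (A *ᵥ u)) (A *ᵥ u)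
    rw [← Matrix.vecMulVec_eq, Matrix.smul_vecMulVec] at this
    rw [this, Matrix.det_unique (n := Unit)]
    congr 1
    simp only [Matrix.add_apply, Matrix.one_apply_eq]
    congr 1
    rw [← Matrix.replicateRow_vecMul, Matrix.replicateRow_mul_replicateCol_apply,
      vecMul_mulVec_inv hθ, dotProduct_smul, smul_eq_mul]
  have hinv : (A + t • Matrix.vecMulVec (A *ᵥ u) (A *ᵥ u))⁻¹ =
      A⁻¹ - (t / (1 + t * a)) • Matrix.vecMulVec u u := by
    refine Matrix.inv_eq_right_inv ?_
    rw [add_mul, mul_sub, mul_sub, Matrix.mul_nonsing_inv _ hθ.det_pos.ne'.isUnit,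
      Matrix.mul_smul, Matrix.mul_smul, Matrix.smul_mul, Matrix.smul_mul, Matrix.mul_vecMulVec,
      Matrix.vecMulVec_mul, vecMul_mulVec_inv hθ, Matrix.vecMulVec_mul_vecMulVec,
      dotProduct_comm, ← ha]
    ext i j
    simp only [Matrix.add_apply, Matrix.sub_apply, Matrix.smul_apply, Matrix.vecMulVec_apply,
      smul_eq_mul, Pi.smul_apply]
    field_simp
    ring
  have hd := hθ.det_pos
  have hd' : 0 < A.det * (1 + t * a) := mul_pos hd ht
  rw [log_density (by rw [hcov, hdet]; exact hd'), log_density hd, hcov, hmean,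
    hdet, hinv, ← mul_assoc, Real.log_mul (by positivity) ht.ne', Matrix.sub_mulVec,
    Matrix.smul_mulVec, Matrix.vecMulVec_mulVec, dotProduct_sub, dotProduct_smul,
    dotProduct_smul]
  simp only [smul_eq_mul, MulOpposite.smul_eq_mul_unop, MulOpposite.unop_op]
  rw [dotProduct_comm _ u]
  ring

theorem integrable_of_continuous {ν : Measure (Vec N)} [IsFiniteMeasure ν] {W : Set (Vec N)}
    (hW : IsCompact W) (hν : ν Wᶜ = 0) {f : Vec N → ℝ} (hf : Continuous f) : Integrable f ν := by
  have : ν.restrict W = ν := Measure.restrict_eq_self_of_ae_mem (by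
    rw [ae_iff]; exact hν)
  rw [← this]
  exact hf.continuousOn.integrableOn_compact hW

theorem eventually_add_smul_mem_of_mem_interior {Θ : Set (Param N)} {θ : Param N}
    (hθ : θ ∈ interior Θ) (v : Param N) : ∀ᶠ t : ℝ in 𝓝 0, θ + t • v ∈ Θ := by
  have hc : Continuous fun t : ℝ => θ + t • v := by
    refine Continuous.prodMk (by fun_prop) (Continuous.subtype_mk ?_ _)
    fun_prop
  exact hc.continuousAt.preimage_mem_nhds (x := 0)
    (by simpa using mem_interior_iff_mem_nhds.1 hθ)

theorem continuous_dotProduct_sub (u : Fin N → ℝ) (m : Vec N) :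
    Continuous fun w : Vec N => u ⬝ᵥ (w - m).ofLp := by
  fun_prop

theorem continuous_log_density {θ : Param N} (hθ : (covMatrix θ).PosDef) :
    Continuous fun w => Real.log (density θ w) :=
  (continuous_density θ).log fun w => (density_pos hθ w).ne'

/-- A Gaussian parameter in the interior of the admissible set that maximizes the expected
log-likelihood under `ν` matches the first two moments of `ν`. -/
theorem moments_of_isMaxOn {ν : Measure (Vec N)} [IsFiniteMeasure ν] {W : Set (Vec N)}
    (hW : IsCompact W) (hν : ν Wᶜ = 0) {Θ : Set (Param N)}
    (hΘ : ∀ θ ∈ Θ, (covMatrix θ).PosDef) {θ : Param N} (hint : θ ∈ interior Θ)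
    (hmax : IsMaxOn (fun θ => ∫ w, Real.log (density θ w) ∂ν) Θ θ) (u : Fin N → ℝ) :
    ∫ w, u ⬝ᵥ (w - mean θ).ofLp ∂ν = 0 ∧
      ∫ w, (u ⬝ᵥ (w - mean θ).ofLp) ^ 2 ∂ν = ν.real univ * (u ⬝ᵥ covMatrix θ *ᵥ u) := by
  have hθ := hΘ θ (interior_subset hint)
  have hi0 := integrable_of_continuous hW hν (continuous_log_density hθ)
  have hi1 := integrable_of_continuous hW hν (continuous_dotProduct_sub u (mean θ))
  have hi2 := integrable_of_continuous hW hν ((continuous_dotProduct_sub u (mean θ)).fun_pow 2)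
  set a := u ⬝ᵥ covMatrix θ *ᵥ u
  set m := ∫ w, u ⬝ᵥ (w - mean θ).ofLp ∂ν
  set V := ∫ w, (u ⬝ᵥ (w - mean θ).ofLp) ^ 2 ∂ν
  set Z := ν.real univ
  constructor
  -- This is the objective along the mean direction minus its value at `t = 0`; its derivative there
  -- is the first moment `m`.
  · have hloc : IsLocalMax (fun t : ℝ => t * m - t ^ 2 / 2 * a * Z) 0 := by
      filter_upwards [eventually_add_smul_mem_of_mem_interior hint
        (meanDirection (covMatrix θ *ᵥ u))] with t ht
      have h := hmax ht
      simp only [mem_ofPred_eq, log_density_add_meanDirection hθ] at h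
      have hi3 : Integrable (fun w => Real.log (density θ w) +
          t * (u ⬝ᵥ (w - mean θ).ofLp)) ν := hi0.add (hi1.const_mul t)
      rw [integral_sub hi3 (integrable_const _),
        integral_add hi0 (hi1.const_mul t), integral_const_mul, integral_const, smul_eq_mul] at h
      simp only [zero_mul, ne_eq, OfNat.ofNat_ne_zero, not_false_eq_true, zero_pow, zero_div,
        sub_zero]
      linarith
    have hd : HasDerivAt (fun t : ℝ => t * m - t ^ 2 / 2 * a * Z) m 0 := by
      have := ((hasDerivAt_id (0 : ℝ)).mul_const m).fun_sub
        (((((hasDerivAt_id (0 : ℝ)).pow 2).div_const 2).mul_const a).mul_const Z)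
      simpa using this
    exact hloc.hasDerivAt_eq_zero hd
  · have hpos : ∀ᶠ t : ℝ in 𝓝 0, 0 < 1 + t * a := by
      have hc : Continuous fun t : ℝ => 1 + t * a := by fun_prop
      exact hc.continuousAt.eventually_const_lt (by simp)
    -- The same along the covariance direction, where the derivative at `0` is `(V - a * Z) / 2`.
    have hloc : IsLocalMax (fun t : ℝ => 1 / 2 * (t / (1 + t * a)) * V -
        1 / 2 * Real.log (1 + t * a) * Z) 0 := by
      filter_upwards [hpos, eventually_add_smul_mem_of_mem_interior hint
        (covDirection (covMatrix θ *ᵥ u))] with t hta ht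
      have h := hmax ht
      simp only [mem_ofPred_eq, log_density_add_covDirection hθ u hta] at h
      have hi3 : Integrable (fun w => Real.log (density θ w) -
          1 / 2 * Real.log (1 + t * a)) ν := hi0.sub (integrable_const _)
      rw [integral_add hi3 (hi2.const_mul _),
        integral_sub hi0 (integrable_const _), integral_const_mul (1 / 2 * (t / (1 + t * a))),
        integral_const, smul_eq_mul] at h
      simp only [zero_mul, zero_div, mul_zero, add_zero, Real.log_one, sub_zero]
      linarith
    have hd : HasDerivAt (fun t : ℝ => 1 / 2 * (t / (1 + t * a)) * V -
        1 / 2 * Real.log (1 + t * a) * Z) (1 / 2 * V - 1 / 2 * a * Z) 0 := by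
      have h1 : HasDerivAt (fun t : ℝ => 1 + t * a) a 0 := by
        simpa using ((hasDerivAt_id (0 : ℝ)).mul_const a).const_add 1
      have h2 := (((hasDerivAt_id (0 : ℝ)).div h1 (by simp)).const_mul (1 / 2)).mul_const V
      have h3 := ((h1.log (by simp)).const_mul (1 / 2)).mul_const Z
      simpa using h2.fun_sub h3
    have := hloc.hasDerivAt_eq_zero hd
    linarith

end Gaussian

end MRASPlanner

noncomputable section

namespace MRASPlanner

/-! ### The Gaussian conditioned on the weight domain -/

section SamplingLaw

variable {N : ℕ} {W : Set (Vec N)} {θ : Param N}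

theorem measurable_ofReal_density (θ : Param N) :
    Measurable fun w => ENNReal.ofReal (density θ w) :=
  (continuous_density θ).measurable.ennreal_ofReal

theorem gaussianMass_pos (hθ : (covMatrix θ).PosDef) {B : Set (Vec N)} (hB : 0 < volume B) :
    (volume.withDensity fun w => ENNReal.ofReal (density θ w)) B ≠ 0 := by
  rw [Ne, withDensity_apply_eq_zero (measurable_ofReal_density θ)]
  have : {w | ENNReal.ofReal (density θ w) ≠ 0} = univ := by
    ext w
    simpa using density_pos hθ w
  rw [this, univ_inter]
  exact hB.ne'

theorem gaussianMass_ne_top (hW : IsCompact W) (θ : Param N) :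
    (volume.withDensity fun w => ENNReal.ofReal (density θ w)) W ≠ ∞ := by
  rw [withDensity_apply _ hW.measurableSet]
  exact (setLIntegral_lt_top_of_isCompact hW.measure_lt_top.ne hW
    (continuous_real_toNNReal.comp (continuous_density θ))).ne

theorem isProbabilityMeasure_samplingLaw (hW : IsCompact W) (hWpos : 0 < volume W)
    (hθ : (covMatrix θ).PosDef) : IsProbabilityMeasure (samplingLaw W θ) :=
  cond_isProbabilityMeasure_of_finite (gaussianMass_pos hθ hWpos) (gaussianMass_ne_top hW θ)

/-- The Gaussian density is positive everywhere, so each sample has a positive chance of landing in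
`B`. -/
theorem samplingLaw_compl_lt_one (hW : IsCompact W) (hθ : (covMatrix θ).PosDef)
    {B : Set (Vec N)} (hBm : MeasurableSet B) (hBW : B ⊆ W) (hB : 0 < volume B) :
    samplingLaw W θ Bᶜ < 1 := by
  have := isProbabilityMeasure_samplingLaw hW (hB.trans_le (measure_mono hBW)) hθ
  rw [prob_compl_eq_one_sub hBm]
  refine ENNReal.sub_lt_self ENNReal.one_ne_top one_ne_zero (ne_of_gt ?_)
  rw [samplingLaw, cond_apply hW.measurableSet, inter_eq_self_of_subset_right hBW]
  exact ENNReal.mul_pos (ENNReal.inv_ne_zero.2 (gaussianMass_ne_top hW θ))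
    (gaussianMass_pos hθ hB)

theorem samplingLaw_eq_zero (hW : MeasurableSet W) (θ : Param N) {B : Set (Vec N)}
    (hB : volume (W ∩ B) = 0) : samplingLaw W θ B = 0 := by
  rw [samplingLaw, cond_apply hW, withDensity_absolutelyContinuous _ _ hB, mul_zero]

end SamplingLaw

/-! ### Target measures and their concentration at the minimizer -/

/-- The standing assumptions on the cost `J` and the weighting function `S` over `W`:
the minimizer `w₀` is well separated and the sublevel sets above the minimum have positive
measure. -/
structure IsRegularCost {N : ℕ} (J : Vec N → ℝ) (S : ℝ → ℝ) (W : Set (Vec N)) (w₀ : Vec N) :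
    Prop where
  isCompact : IsCompact W
  measurable : Measurable (W.domRestrict J)
  mem : w₀ ∈ W
  le : ∀ w ∈ W, J w₀ ≤ J w
  volume_sublevel_pos : ∀ c, J w₀ < c → 0 < volume {w ∈ W | J w ≤ c}
  gap : ∀ δ > 0, ∃ η > 0, ∀ w ∈ W, δ ≤ ‖w - w₀‖ → J w₀ + η ≤ J w
  strictAnti : StrictAntiOn S (J '' W)
  pos : ∀ c ∈ J '' W, 0 < S c

open Classical in
/-- The unnormalized density `S(J(w))ᵏ 𝟙{J(w) ≤ γ}`. -/
def targetWeight {N : ℕ} (J : Vec N → ℝ) (S : ℝ → ℝ) (k : ℕ) (γ : ℝ) (w : Vec N) : ℝ :=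
  S (J w) ^ k * (if J w ≤ γ then 1 else 0)

/-- The measure on `W` with density `S(J(w))ᵏ 𝟙{J(w) ≤ γ}`. -/
def targetMeasure {N : ℕ} (J : Vec N → ℝ) (S : ℝ → ℝ) (W : Set (Vec N)) (k : ℕ) (γ : ℝ) :
    Measure (Vec N) :=
  (volume.restrict W).withDensity fun w => ENNReal.ofReal (targetWeight J S k γ w)

namespace IsRegularCost

variable {N : ℕ} {J : Vec N → ℝ} {S : ℝ → ℝ} {W : Set (Vec N)} {w₀ : Vec N}

theorem measurableSet_sublevel (h : IsRegularCost J S W w₀) (c : ℝ) :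
    MeasurableSet {w ∈ W | J w ≤ c} := by
  have := h.isCompact.measurableSet.subtype_image (h.measurable measurableSet_Iic :
    MeasurableSet (W.domRestrict J ⁻¹' Iic c))
  convert this using 1
  ext w
  simp [and_comm]

theorem le_S (h : IsRegularCost J S W w₀) {w : Vec N} (hw : w ∈ W) : S (J w) ≤ S (J w₀) :=
  h.strictAnti.antitoneOn (mem_image_of_mem J h.mem) (mem_image_of_mem J hw) (h.le w hw)

theorem S_pos (h : IsRegularCost J S W w₀) {w : Vec N} (hw : w ∈ W) : 0 < S (J w) :=
  h.pos _ (mem_image_of_mem J hw)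

theorem targetWeight_nonneg (h : IsRegularCost J S W w₀) (k : ℕ) (γ : ℝ) {w : Vec N}
    (hw : w ∈ W) : 0 ≤ targetWeight J S k γ w :=
  mul_nonneg (pow_nonneg (h.S_pos hw).le _) (by split_ifs <;> norm_num)

theorem targetWeight_le (h : IsRegularCost J S W w₀) (k : ℕ) (γ : ℝ) {w : Vec N}
    (hw : w ∈ W) : targetWeight J S k γ w ≤ S (J w) ^ k :=
  mul_le_of_le_one_right (pow_nonneg (h.S_pos hw).le _) (by split_ifs <;> norm_num)

/-- `S` is controlled only on `J '' W`, where it is monotone and bounded; it extends to an antitone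
function on `ℝ`, which is measurable. -/
theorem aemeasurable_targetWeight (h : IsRegularCost J S W w₀) (k : ℕ) (γ : ℝ) :
    AEMeasurable (targetWeight J S k γ) (volume.restrict W) := by
  rw [aemeasurable_restrict_iff_comap_subtype h.isCompact.measurableSet]
  obtain ⟨S', hS', hEq⟩ := h.strictAnti.antitoneOn.exists_antitone_extension
    ⟨0, by rintro _ ⟨c, hc, rfl⟩; exact (h.pos c hc).le⟩
    ⟨S (J w₀), by rintro _ ⟨_, ⟨w, hw, rfl⟩, rfl⟩; exact h.le_S hw⟩
  have hJ : Measurable fun x : W => J x := h.measurable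
  have : targetWeight J S k γ ∘ ((↑) : W → Vec N) = fun x : W => S' (J x) ^ k *
      (if J x ≤ γ then 1 else 0) := by
    ext x
    simp only [Function.comp_apply, targetWeight, hEq (mem_image_of_mem J x.2)]
  rw [this]
  exact (((hS'.measurable.comp hJ).pow_const k).mul
    (Measurable.ite (hJ measurableSet_Iic) measurable_const measurable_const)).aemeasurable

theorem targetMeasure_apply_le (h : IsRegularCost J S W w₀) (k : ℕ) (γ : ℝ) {B : Set (Vec N)}
    (hB : MeasurableSet B) {s : ℝ} (hs : ∀ w ∈ W, w ∈ B → targetWeight J S k γ w ≤ s) :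
    targetMeasure J S W k γ B ≤ ENNReal.ofReal s * volume W := by
  rw [targetMeasure, withDensity_apply _ hB, Measure.restrict_restrict hB]
  calc ∫⁻ w in B ∩ W, ENNReal.ofReal (targetWeight J S k γ w)
      ≤ ∫⁻ _ in B ∩ W, ENNReal.ofReal s :=
        setLIntegral_mono' (hB.inter h.isCompact.measurableSet) fun w hw =>
          ENNReal.ofReal_le_ofReal (hs w hw.2 hw.1)
    _ ≤ ENNReal.ofReal s * volume W := by
        rw [setLIntegral_const]
        gcongr
        exact inter_subset_right

theorem isFiniteMeasure_targetMeasure (h : IsRegularCost J S W w₀) (k : ℕ) (γ : ℝ) :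
    IsFiniteMeasure (targetMeasure J S W k γ) := by
  refine ⟨(h.targetMeasure_apply_le k γ MeasurableSet.univ (s := S (J w₀) ^ k)
    fun w hw _ => (h.targetWeight_le k γ hw).trans
      (pow_le_pow_left₀ (h.S_pos hw).le (h.le_S hw) k)).trans_lt ?_⟩
  exact ENNReal.mul_lt_top ENNReal.ofReal_lt_top h.isCompact.measure_lt_top

theorem targetMeasure_compl (h : IsRegularCost J S W w₀) (k : ℕ) (γ : ℝ) :
    targetMeasure J S W k γ Wᶜ = 0 := by
  refine withDensity_absolutelyContinuous _ _ ?_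
  rw [Measure.restrict_apply h.isCompact.measurableSet.compl, compl_inter_self, measure_empty]

theorem le_targetMeasure_univ (h : IsRegularCost J S W w₀) (k : ℕ) {γ : ℝ} {w : Vec N}
    (hw : w ∈ W) (hγ : J w ≤ γ) :
    ENNReal.ofReal (S (J w) ^ k) * volume {v ∈ W | J v ≤ J w} ≤
      targetMeasure J S W k γ univ := by
  have hm := h.measurableSet_sublevel (J w)
  refine le_trans ?_ (measure_mono (subset_univ {v ∈ W | J v ≤ J w}))
  rw [targetMeasure, withDensity_apply _ hm, Measure.restrict_restrict hm,
    inter_eq_self_of_subset_left (fun v hv => hv.1), ← setLIntegral_const]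
  refine setLIntegral_mono' hm fun v hv => ENNReal.ofReal_le_ofReal ?_
  rw [targetWeight, if_pos (hv.2.trans hγ), mul_one]
  exact pow_le_pow_left₀ (h.S_pos hw).le (h.strictAnti.antitoneOn
    (mem_image_of_mem J hv.1) (mem_image_of_mem J hw) hv.2) k

/-- A set of positive volume contains a point other than `w₀`, and the gap makes its cost strictly
larger. Comparison levels must be attained costs because `S` is decreasing only on those. -/
theorem exists_cost_between [NullSingletonClass (volume : Measure (Vec N))] (h : IsRegularCost J S W w₀)
    {c : ℝ} (hc : J w₀ < c) : ∃ w ∈ W, J w₀ < J w ∧ J w ≤ c := by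
  obtain ⟨w, hw, hne⟩ : ∃ w ∈ {w ∈ W | J w ≤ c}, w ≠ w₀ := by
    by_contra! hcon
    exact (h.volume_sublevel_pos c hc).ne' (measure_mono_null (t := {w₀}) hcon
      (measure_singleton w₀))
  obtain ⟨η, hη, hgap⟩ := h.gap ‖w - w₀‖ (norm_pos_iff.2 (sub_ne_zero.2 hne))
  exact ⟨w, hw.1, by linarith [hgap w hw.1 le_rfl], hw.2⟩

theorem volume_inter_le_min [NullSingletonClass (volume : Measure (Vec N))] (h : IsRegularCost J S W w₀) :
    volume (W ∩ {w ∈ W | J w ≤ J w₀}) = 0 := by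
  refine measure_mono_null (t := {w₀}) ?_ (measure_singleton w₀)
  rintro w ⟨-, hw, hle⟩
  by_contra hne
  obtain ⟨η, hη, hgap⟩ := h.gap ‖w - w₀‖ (norm_pos_iff.2 (sub_ne_zero.2 hne))
  linarith [hgap w hw le_rfl]

theorem targetMeasure_real_univ_pos [NullSingletonClass (volume : Measure (Vec N))]
    (h : IsRegularCost J S W w₀) (k : ℕ) {γ : ℝ} (hγ : J w₀ < γ) :
    0 < (targetMeasure J S W k γ).real univ := by
  obtain ⟨w, hw, hlt, hle⟩ := h.exists_cost_between hγ
  have := h.isFiniteMeasure_targetMeasure k γ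
  refine ENNReal.toReal_pos (ne_of_gt ?_) (measure_ne_top _ _)
  refine lt_of_lt_of_le ?_ (h.le_targetMeasure_univ k hw hle)
  exact ENNReal.mul_pos (by simpa using pow_pos (h.S_pos hw) k)
    (h.volume_sublevel_pos _ hlt).ne'

/-- Away from the minimizer, the target measures lose their relative mass geometrically. -/
theorem exists_targetMeasure_far_le [NullSingletonClass (volume : Measure (Vec N))]
    (h : IsRegularCost J S W w₀) {δ : ℝ} (hδ : 0 < δ) :
    ∃ C r : ℝ, 0 ≤ r ∧ r < 1 ∧ ∀ (k : ℕ) (γ : ℝ), J w₀ < γ →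
      (targetMeasure J S W k γ).real {w | δ ≤ ‖w - w₀‖} ≤
        C * r ^ k * (targetMeasure J S W k γ).real univ := by
  obtain ⟨η, hη, hgap⟩ := h.gap δ hδ
  -- The points satisfy `J w₀ < J w₁ < J w₂ < J w₀ + η`. Far weights are at most `S (J w₂) ^ k`,
  -- weights on `{J ≤ J w₁}` at least `S (J w₁) ^ k` once `γ ≥ J w₁`; the ratio gives `r < 1`.
  obtain ⟨w₂, hw₂, hlt₂, hle₂⟩ := h.exists_cost_between
    (show J w₀ < J w₀ + η / 2 by linarith)
  obtain ⟨w₁, hw₁, hlt₁, hle₁⟩ := h.exists_cost_between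
    (show J w₀ < (J w₀ + J w₂) / 2 by linarith)
  have hS : S (J w₂) < S (J w₁) := h.strictAnti (mem_image_of_mem J hw₁)
    (mem_image_of_mem J hw₂) (by linarith)
  have hs1 := h.S_pos hw₁
  have hs2 := h.S_pos hw₂
  have hfin := h.isCompact.measure_lt_top (μ := volume)
  have hvfin : volume {v ∈ W | J v ≤ J w₁} ≠ ∞ :=
    ((measure_mono fun v hv => hv.1).trans_lt hfin).ne
  have hv : 0 < (volume {v ∈ W | J v ≤ J w₁}).toReal :=
    ENNReal.toReal_pos (h.volume_sublevel_pos _ hlt₁).ne' hvfin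
  have hmeas : MeasurableSet {w | δ ≤ ‖w - w₀‖} :=
    measurableSet_le measurable_const (by fun_prop)
  refine ⟨(volume W).toReal / (volume {v ∈ W | J v ≤ J w₁}).toReal, S (J w₂) / S (J w₁),
    (div_pos hs2 hs1).le, (div_lt_one hs1).2 hS, fun k γ hγ => ?_⟩
  have := h.isFiniteMeasure_targetMeasure k γ
  -- For small `γ` the indicator removes all far points; otherwise `γ ≥ J w₁`. Hence `C` and `r` do
  -- not depend on `γ`.
  rcases lt_or_ge γ (J w₀ + η) with hlt | hge
  · have h0 : targetMeasure J S W k γ {w | δ ≤ ‖w - w₀‖} ≤ ENNReal.ofReal 0 * volume W := by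
      refine h.targetMeasure_apply_le k γ hmeas fun w hw hfar => ?_
      rw [targetWeight, if_neg (by linarith [hgap w hw hfar]), mul_zero]
    rw [ENNReal.ofReal_zero, zero_mul, nonpos_iff_eq_zero] at h0
    rw [measureReal_def, h0, ENNReal.toReal_zero]
    positivity
  · have hup := h.targetMeasure_apply_le k γ hmeas (s := S (J w₂) ^ k) fun w hw hfar =>
      (h.targetWeight_le k γ hw).trans (pow_le_pow_left₀ (h.S_pos hw).le
        (h.strictAnti.antitoneOn (mem_image_of_mem J hw₂) (mem_image_of_mem J hw)
          (by linarith [hgap w hw hfar])) k)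
    have hlow := h.le_targetMeasure_univ k hw₁ (show J w₁ ≤ γ by linarith)
    have hup' := ENNReal.toReal_mono (ENNReal.mul_ne_top ENNReal.ofReal_ne_top hfin.ne) hup
    have hlow' := ENNReal.toReal_mono (measure_ne_top _ _) hlow
    rw [ENNReal.toReal_mul, ENNReal.toReal_ofReal (by positivity)] at hup' hlow'
    set v := (volume {v ∈ W | J v ≤ J w₁}).toReal
    set V := (volume W).toReal
    have hVv : 0 ≤ V / v * (S (J w₂) / S (J w₁)) ^ k := by positivity
    refine hup'.trans (le_trans (le_of_eq ?_) (mul_le_mul_of_nonneg_left hlow' hVv))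
    rw [div_pow]
    field_simp

/-- The normalized target measures concentrate at the minimizer. -/
theorem tendsto_integral_div_targetMeasure [NullSingletonClass (volume : Measure (Vec N))]
    (h : IsRegularCost J S W w₀) {γ : ℕ → ℝ} (hγ : ∀ᶠ k in atTop, J w₀ < γ k)
    {f : Vec N → ℝ} (hf : Continuous f) (hf0 : ∀ w, 0 ≤ f w) (hfw : f w₀ = 0) :
    Tendsto (fun k => (∫ w, f w ∂(targetMeasure J S W k (γ k))) /
      (targetMeasure J S W k (γ k)).real univ) atTop (𝓝 0) := by
  rw [Metric.tendsto_nhds]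
  intro ε hε
  obtain ⟨δ, hδ, hball⟩ := Metric.continuous_iff.1 hf w₀ (ε / 2) (by positivity)
  obtain ⟨M, hM⟩ := h.isCompact.exists_bound_of_continuousOn hf.continuousOn
  have hM0 : 0 ≤ M := (norm_nonneg _).trans (hM w₀ h.mem)
  obtain ⟨C, r, hr0, hr1, hfar⟩ := h.exists_targetMeasure_far_le hδ
  have hlim : Tendsto (fun k : ℕ => M * (C * r ^ k)) atTop (𝓝 0) := by
    simpa using ((tendsto_pow_atTop_nhds_zero_of_lt_one hr0 hr1).const_mul C).const_mul M
  filter_upwards [hγ, hlim.eventually_lt_const (show (0 : ℝ) < ε / 2 by positivity)]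
    with k hk hsmall
  set ν := targetMeasure J S W k (γ k)
  have hfinν : IsFiniteMeasure ν := h.isFiniteMeasure_targetMeasure k (γ k)
  have hZ : 0 < ν.real univ := h.targetMeasure_real_univ_pos k hk
  have hmeas : MeasurableSet {w | δ ≤ ‖w - w₀‖} :=
    measurableSet_le measurable_const (by fun_prop)
  have hbound : ∫ w, f w ∂ν ≤ ε / 2 * ν.real univ + M * ν.real {w | δ ≤ ‖w - w₀‖} := by
    have hi2 : Integrable ({w | δ ≤ ‖w - w₀‖}.indicator fun _ => M) ν :=
      (integrable_const M).indicator hmeas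
    have : ∫ w, f w ∂ν ≤ ∫ w, (ε / 2 + {w | δ ≤ ‖w - w₀‖}.indicator (fun _ => M) w) ∂ν := by
      refine integral_mono_ae
        (integrable_of_continuous h.isCompact (h.targetMeasure_compl k (γ k)) hf)
        ((integrable_const _).add hi2) ?_
      have hae : ∀ᵐ w ∂ν, w ∈ W := by
        rw [ae_iff]
        exact h.targetMeasure_compl k (γ k)
      filter_upwards [hae] with w hw
      by_cases hwδ : δ ≤ ‖w - w₀‖
      · rw [indicator_of_mem (show w ∈ {w | δ ≤ ‖w - w₀‖} from hwδ)]
        linarith [(le_abs_self _).trans (hM w hw)]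
      · rw [indicator_of_notMem (show w ∉ {w | δ ≤ ‖w - w₀‖} from hwδ)]
        have := hball w (by rw [dist_eq_norm]; exact not_le.1 hwδ)
        rw [hfw, Real.dist_eq, sub_zero] at this
        linarith [le_abs_self (f w)]
    rwa [integral_add (integrable_const _) hi2, integral_const, integral_indicator_const _ hmeas,
      smul_eq_mul, smul_eq_mul, mul_comm _ (ε / 2), mul_comm _ M] at this
  rw [Real.dist_eq, sub_zero, abs_of_nonneg (div_nonneg (integral_nonneg hf0) hZ.le),
    div_lt_iff₀ hZ]
  have h1 := mul_le_mul_of_nonneg_left (hfar k (γ k) hk) hM0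
  have h2 := mul_lt_mul_of_pos_right hsmall hZ
  nlinarith

/-- The objective of the parameter update is a positive multiple of the expected log-likelihood
under the target measure. -/
theorem exists_updateObjective_eq (h : IsRegularCost J S W w₀) (hW : 0 < volume W) {θk : Param N}
    (hθ : (covMatrix θk).PosDef) (k : ℕ) (γ : ℝ) :
    ∃ c : ℝ, 0 < c ∧ ∀ θ, updateObjective J S W k γ θk θ =
      c * ∫ w, Real.log (density θ w) ∂(targetMeasure J S W k γ) := by
  set μ := (volume : Measure (Vec N)).withDensity fun w => ENNReal.ofReal (density θk w) with hμ
  have hWm := h.isCompact.measurableSet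
  -- The factor is the normalizing constant of conditioning on `W`.
  refine ⟨(μ W)⁻¹.toReal, ENNReal.toReal_pos
    (ENNReal.inv_ne_zero.2 (gaussianMass_ne_top h.isCompact θk))
    (ENNReal.inv_ne_top.2 (gaussianMass_pos hθ hW)), fun θ => ?_⟩
  rw [updateObjective, samplingLaw, ProbabilityTheory.cond, integral_smul_measure, smul_eq_mul,
    restrict_withDensity hWm, targetMeasure,
    integral_withDensity_eq_integral_toReal_smul (measurable_ofReal_density θk)
      (ae_of_all _ fun _ => ENNReal.ofReal_lt_top),
    integral_withDensity_eq_integral_toReal_smul₀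
      (h.aemeasurable_targetWeight k γ).ennreal_ofReal
      (ae_of_all _ fun _ => ENNReal.ofReal_lt_top)]
  congr 1
  refine setIntegral_congr_fun hWm fun w hw => ?_
  have hp := density_pos hθ w
  simp only [smul_eq_mul]
  rw [ENNReal.toReal_ofReal hp.le, ENNReal.toReal_ofReal (h.targetWeight_nonneg k γ hw),
    targetWeight]
  field_simp

/-- The maximizer of the parameter update has the same second moments about the minimizer as the
target measure. -/
theorem second_moment_update_eq [NullSingletonClass (volume : Measure (Vec N))] (h : IsRegularCost J S W w₀)
    {θk : Param N} (hθk : (covMatrix θk).PosDef) {k : ℕ} {γ : ℝ} (hγ : J w₀ < γ)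
    {Θ : Set (Param N)} (hΘ : ∀ θ ∈ Θ, (covMatrix θ).PosDef) {θ : Param N}
    (hint : θ ∈ interior Θ) (hmax : IsMaxOn (updateObjective J S W k γ θk) Θ θ)
    (u : Fin N → ℝ) :
    (u ⬝ᵥ covMatrix θ *ᵥ u) + (u ⬝ᵥ (mean θ - w₀).ofLp) ^ 2 =
      (∫ w, (u ⬝ᵥ (w - w₀).ofLp) ^ 2 ∂(targetMeasure J S W k γ)) /
        (targetMeasure J S W k γ).real univ := by
  have hW : 0 < volume W :=
    (h.volume_sublevel_pos γ hγ).trans_le (measure_mono fun v hv => hv.1)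
  obtain ⟨c, hc, hobj⟩ := h.exists_updateObjective_eq hW hθk k γ
  set ν := targetMeasure J S W k γ
  have hfin : IsFiniteMeasure ν := h.isFiniteMeasure_targetMeasure k γ
  have hν := h.targetMeasure_compl k γ
  have hmax' : IsMaxOn (fun θ => ∫ w, Real.log (density θ w) ∂ν) Θ θ := by
    intro θ' hθ'
    have := hmax hθ'
    simp only [mem_ofPred_eq, hobj] at this
    exact le_of_mul_le_mul_left this hc
  obtain ⟨h1, h2⟩ := moments_of_isMaxOn h.isCompact hν hΘ hint hmax' u
  have hZ : 0 < ν.real univ := h.targetMeasure_real_univ_pos k hγ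
  have hi1 := integrable_of_continuous h.isCompact hν (continuous_dotProduct_sub u (mean θ))
  have hi2 := integrable_of_continuous h.isCompact hν
    ((continuous_dotProduct_sub u (mean θ)).fun_pow 2)
  set d := u ⬝ᵥ (mean θ - w₀).ofLp
  -- Recentring from `mean θ` to `w₀`: the cross term integrates to zero by the first-moment
  -- identity.
  have hsq : ∀ w : Vec N, (u ⬝ᵥ (w - w₀).ofLp) ^ 2 =
      (u ⬝ᵥ (w - mean θ).ofLp) ^ 2 + 2 * d * (u ⬝ᵥ (w - mean θ).ofLp) + d ^ 2 := by
    intro w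
    have : u ⬝ᵥ (w - w₀).ofLp = u ⬝ᵥ (w - mean θ).ofLp + d := by
      rw [← dotProduct_add, ← WithLp.ofLp_add, sub_add_sub_cancel]
    rw [this]
    ring
  have hi3 : Integrable (fun w => (u ⬝ᵥ (w - mean θ).ofLp) ^ 2 +
    2 * d * (u ⬝ᵥ (w - mean θ).ofLp)) ν := hi2.add (hi1.const_mul _)
  simp only [hsq]
  rw [integral_add hi3 (integrable_const _), integral_add hi2 (hi1.const_mul _),
    integral_const_mul, h1, h2, integral_const, smul_eq_mul]
  field_simp
  ring

end IsRegularCost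

end MRASPlanner

end

/-! ### Almost sure behaviour of a run -/

noncomputable section

namespace MRASPlanner

/-- Makes the events that two parameters of the run coincide measurable. -/
instance metrizableSpace_param (N : ℕ) : TopologicalSpace.MetrizableSpace (Param N) := by
  have : TopologicalSpace.MetrizableSpace (Matrix (Fin N) (Fin N) ℝ) :=
    inferInstanceAs (TopologicalSpace.MetrizableSpace (Fin N → Fin N → ℝ))
  have : TopologicalSpace.MetrizableSpace (selfAdjoint (Matrix (Fin N) (Fin N) ℝ)) :=
    IsEmbedding.subtypeVal.metrizableSpace
  infer_instance

namespace PlannerRun.IsRun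

variable {Ω : Type*} [mΩ : MeasurableSpace Ω] {N : ℕ} {R : PlannerRun Ω N} {J : Vec N → ℝ}
  {τ : Tuning} {Pr : Measure Ω} {ℱ : Filtration ℕ mΩ} {S : ℝ → ℝ} {W : Set (Vec N)}
  {Θ : Set (Param N)} {θ₀ : Param N} {w₀ : Vec N}

theorem ae_min_lt_cost_sample [NullSingletonClass (volume : Measure (Vec N))]
    (hR : R.IsRun J τ Pr ℱ S W Θ θ₀) (h : IsRegularCost J S W w₀) :
    ∀ᵐ ω ∂Pr, ∀ k, 1 ≤ k → ∀ i, J w₀ < J (R.sample k i ω) := by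
  simp only [ae_all_iff]
  intro k hk i
  have hWm := h.isCompact.measurableSet
  set B : Set (Vec N) := Wᶜ ∪ {w ∈ W | J w ≤ J w₀}
  have hB : MeasurableSet B := hWm.compl.union (h.measurableSet_sublevel _)
  have hnull : volume (W ∩ B) = 0 := by
    rw [inter_union_distrib_left, inter_compl_self, empty_union, h.volume_inter_le_min]
  -- Only the `i`-th sample is constrained, so the product has a vanishing factor.
  have hs := hR.sampling k hk univ MeasurableSet.univ (i + 1)
    (fun j => if j = i then B else univ) (fun j => by
      split_ifs
      · exact hB
      · exact MeasurableSet.univ)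
  have h0 : ∀ ω, ∏ j ∈ Finset.range (i + 1),
      samplingLaw W (R.θ k ω) (if j = i then B else univ) = 0 := fun ω =>
    Finset.prod_eq_zero (i := i) (by simp) (by
      rw [if_pos rfl, samplingLaw_eq_zero hWm _ hnull])
  simp only [h0, lintegral_zero] at hs
  rw [ae_iff]
  refine measure_mono_null (fun ω hω => ?_) hs
  refine ⟨mem_univ _, mem_iInter₂.2 fun j _ => ?_⟩
  by_cases hj : j = i
  · subst hj
    rw [if_pos rfl]
    by_cases hwW : R.sample k j ω ∈ W
    · exact Or.inr ⟨hwW, not_lt.1 hω⟩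
    · exact Or.inl hwW
  · rw [if_neg hj]
    exact mem_univ _

/-- `Θ` need not be convex, so smoothed parameters may leave it; definiteness survives because the
maximizer has weight `1 - lam > 0`. -/
theorem ae_posDef (hR : R.IsRun J τ Pr ℱ S W Θ θ₀) (hθ₀ : θ₀ ∈ Θ)
    (hΘ : ∀ θ ∈ Θ, (covMatrix θ).PosDef) :
    ∀ᵐ ω ∂Pr, ∀ k, 1 ≤ k → (covMatrix (R.θ k ω)).PosDef := by
  filter_upwards [hR.init, hR.parameter] with ω hinit hpar k hk
  induction k, hk using Nat.le_induction with
  | base => exact hinit.1 ▸ hΘ _ hθ₀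
  | succ k hk ih =>
    by_cases hU : R.Updates J τ k ω
    · obtain ⟨⟨hmem, -⟩, heq⟩ := (hpar k hk).1 hU
      have hcov : covMatrix (R.θ (k + 1) ω) = τ.lam • covMatrix (R.θ k ω) +
          (1 - τ.lam) • covMatrix (R.θopt (k + 1) ω) := by
        rw [heq]
        rfl
      rw [hcov]
      exact Matrix.PosDef.posSemidef_add (ih.posSemidef.smul τ.lam_nonneg)
        ((hΘ _ hmem).smul (sub_pos.2 τ.lam_lt_one))
    · rw [(hpar k hk).2 hU]
      exact ih

/-- If the sampling distribution stays unchanged forever, a set of positive measure is hit. -/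
theorem measure_frozen_and_missed [IsProbabilityMeasure Pr]
    (hR : R.IsRun J τ Pr ℱ S W Θ θ₀) (hW : IsCompact W)
    (hpd : ∀ᵐ ω ∂Pr, ∀ k, 1 ≤ k → (covMatrix (R.θ k ω)).PosDef) {B : Set (Vec N)}
    (hBm : MeasurableSet B) (hBW : B ⊆ W) (hB : 0 < volume B) {K : ℕ} (hK : 1 ≤ K) :
    Pr {ω | ∀ k, K ≤ k → R.θ k ω = R.θ K ω ∧ R.sample k 0 ω ∉ B} = 0 := by
  set f : Ω → ℝ≥0∞ := fun ω => samplingLaw W (R.θ K ω) Bᶜ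
  have hf1 : ∀ᵐ ω ∂Pr, f ω < 1 := by
    filter_upwards [hpd] with ω hω
    exact samplingLaw_compl_lt_one hW (hω K hK) hBm hBW hB
  set E := {ω | ∀ k, K ≤ k → R.θ k ω = R.θ K ω ∧ R.sample k 0 ω ∉ B} with hE
  -- Frozen up to iteration `K + k` and missed in the `k` iterations before it: these events
  -- decrease to `E` and belong to the history `ℱ (K + k)`, so the sampling law applies on them.
  set D : ℕ → Set Ω := fun k => {ω | ∀ i, i < k → R.θ (K + i) ω = R.θ K ω ∧
    R.sample (K + i) 0 ω ∉ B} ∩ {ω | R.θ (K + k) ω = R.θ K ω} with hD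
  have hθeq : ∀ i k, i ≤ k → MeasurableSet[ℱ (K + k)] {ω | R.θ (K + i) ω = R.θ K ω} :=
    fun i k hik => StronglyMeasurable.measurableSet_eq_fun
      ((hR.θ_meas (K + i) (by omega)).mono (ℱ.mono (by omega)))
      ((hR.θ_meas K hK).mono (ℱ.mono (by omega)))
  have hDm : ∀ k, MeasurableSet[ℱ (K + k)] (D k) := by
    intro k
    refine MeasurableSet.inter ?_ (hθeq k k le_rfl)
    have : {ω | ∀ i, i < k → R.θ (K + i) ω = R.θ K ω ∧ R.sample (K + i) 0 ω ∉ B} =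
        ⋂ i, ⋂ (_ : i < k), ({ω | R.θ (K + i) ω = R.θ K ω} ∩ R.sample (K + i) 0 ⁻¹' Bᶜ) := by
      ext ω
      simp
    rw [this]
    refine MeasurableSet.iInter fun i => MeasurableSet.iInter fun hi =>
      (hθeq i k hi.le).inter ?_
    exact ℱ.mono (show K + i + 1 ≤ K + k by omega) _
      (hR.sample_meas (K + i) (by omega) 0 hBm.compl)
  have hDm' : ∀ k, MeasurableSet (D k) := fun k => ℱ.le _ _ (hDm k)
  have hED : E = ⋂ k, D k := by
    ext ω
    simp only [hE, hD, mem_ofPred_eq, mem_iInter, mem_inter_iff]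
    constructor
    · exact fun h k => ⟨fun i _ => h (K + i) (by omega), (h (K + k) (by omega)).1⟩
    · intro h k hk
      obtain ⟨j, rfl⟩ := Nat.exists_eq_add_of_le hk
      exact (h (j + 1)).1 j (by omega)
  have hEm : MeasurableSet E := hED ▸ MeasurableSet.iInter hDm'
  have hanti : Antitone D := by
    intro j k hjk ω hω
    refine ⟨fun i hi => hω.1 i (by omega), ?_⟩
    rcases hjk.eq_or_lt with rfl | hlt
    · exact hω.2
    · exact (hω.1 j hlt).1
  -- One further miss on `D k`, where the sampling parameter is still `θ_K`, has conditional
  -- probability `f`. Letting `k → ∞` gives `Pr E ≤ ∫ f` over `E` with `f < 1`, which forces `Pr E =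
  -- 0`.
  have hstep : ∀ k, Pr E ≤ ∫⁻ ω in E, f ω ∂Pr + Pr (D k \ E) := by
    intro k
    have hs := hR.sampling (K + k) (by omega) (D k) (hDm k) 1 (fun _ => Bᶜ) fun _ => hBm.compl
    simp only [Finset.prod_range_one] at hs
    have hsub : E ⊆ D k ∩ ⋂ i ∈ Finset.range 1, R.sample (K + k) i ⁻¹' Bᶜ := by
      intro ω hω
      refine ⟨(hED.subset hω : ω ∈ ⋂ k, D k) |> mem_iInter.1 |> (· k),
        mem_iInter₂.2 fun i hi => ?_⟩
      obtain rfl : i = 0 := by simpa using hi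
      exact (hω (K + k) (by omega)).2
    refine (measure_mono hsub).trans ?_
    have hcongr : ∫⁻ ω in D k, samplingLaw W (R.θ (K + k) ω) Bᶜ ∂Pr = ∫⁻ ω in D k, f ω ∂Pr :=
      setLIntegral_congr_fun (hDm' k) fun ω hω => by rw [show R.θ (K + k) ω = R.θ K ω from hω.2]
    have hDE : D k = E ∪ D k \ E := by
      rw [union_sdiff_cancel]
      rw [hED]
      exact iInter_subset _ _
    rw [hs, hcongr]
    nth_rewrite 1 [hDE]
    refine (lintegral_union_le _ _ _).trans (add_le_add le_rfl ?_)
    calc ∫⁻ ω in D k \ E, f ω ∂Pr ≤ ∫⁻ _ in D k \ E, 1 ∂Pr :=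
          lintegral_mono_ae (ae_restrict_of_ae (hf1.mono fun _ h => h.le))
      _ = Pr (D k \ E) := setLIntegral_one _
  have hlim : Tendsto (fun k => Pr (D k \ E)) atTop (𝓝 0) := by
    have := tendsto_measure_iInter_atTop (μ := Pr) (s := fun k => D k \ E)
      (fun k => ((hDm' k).diff hEm).nullMeasurableSet)
      (fun j k hjk => sdiff_subset_sdiff_left (hanti hjk)) ⟨0, measure_ne_top _ _⟩
    have hempty : ⋂ k, D k \ E = ∅ := by
      rw [eq_empty_iff_forall_notMem]
      intro ω hω
      rw [mem_iInter] at hω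
      exact (hω 0).2 (hED ▸ mem_iInter.2 fun k => (hω k).1)
    rwa [hempty, measure_empty] at this
  have hle : Pr E ≤ ∫⁻ ω in E, f ω ∂Pr := by
    have := ge_of_tendsto' (hlim.const_add (∫⁻ ω in E, f ω ∂Pr)) hstep
    rwa [add_zero] at this
  by_contra hne
  have hlt : ∫⁻ ω in E, f ω ∂Pr < ∫⁻ _ in E, 1 ∂Pr := by
    refine lintegral_strict_mono (by rwa [Ne, Measure.restrict_eq_zero]) aemeasurable_const ?_
      (ae_restrict_of_ae hf1)
    refine ne_top_of_le_ne_top (measure_ne_top Pr E) ?_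
    rw [← setLIntegral_one E]
    exact lintegral_mono_ae (ae_restrict_of_ae (hf1.mono fun _ h => h.le))
  rw [setLIntegral_one] at hlt
  exact hle.not_gt hlt

theorem ae_threshold_gt [NullSingletonClass (volume : Measure (Vec N))]
    (hR : R.IsRun J τ Pr ℱ S W Θ θ₀) (h : IsRegularCost J S W w₀) :
    ∀ᵐ ω ∂Pr, ∀ k, 1 ≤ k → J w₀ < R.γ k ω := by
  filter_upwards [hR.init, hR.threshold, hR.ae_min_lt_cost_sample h] with ω hinit hthr hsam k hk
  obtain ⟨j, i, hj, heq⟩ := exists_threshold_eq hinit.2.1 hinit.2.2 hthr hk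
  rw [heq]
  exact hsam j hj i

/-- The parameter update is performed infinitely often. -/
theorem ae_frequently_updates [NullSingletonClass (volume : Measure (Vec N))]
    [IsProbabilityMeasure Pr] (hR : R.IsRun J τ Pr ℱ S W Θ θ₀) (h : IsRegularCost J S W w₀)
    (hθ₀ : θ₀ ∈ Θ) (hΘ : ∀ θ ∈ Θ, (covMatrix θ).PosDef)
    (hτ : τ.stall = StallRule.hold → τ.ε = 0) :
    ∀ᵐ ω ∂Pr, ∃ᶠ k in atTop, R.Updates J τ k ω := by
  -- The frozen threshold is random; rational levels keep the exceptional null sets countable in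
  -- number.
  have hmiss : ∀ᵐ ω ∂Pr, ∀ K : ℕ, 1 ≤ K → ∀ q : ℚ, J w₀ < q →
      ¬ ∀ k, K ≤ k → R.θ k ω = R.θ K ω ∧ R.sample k 0 ω ∉ {w ∈ W | J w ≤ q} := by
    simp only [ae_all_iff]
    intro K hK q hq
    rw [ae_iff]
    simp only [not_not]
    exact hR.measure_frozen_and_missed h.isCompact (hR.ae_posDef hθ₀ hΘ)
      (h.measurableSet_sublevel q) (fun w hw => hw.1) (h.volume_sublevel_pos q hq) hK
  filter_upwards [hR.init, hR.threshold, hR.parameter, hR.ae_threshold_gt h, hmiss]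
    with ω hinit hthr hpar hγ hmissω
  by_contra hcon
  rw [not_frequently] at hcon
  obtain ⟨K₀, hK₀⟩ := eventually_atTop.1 hcon
  -- The shift by two ensures `K - 1 ≥ 1`, so `γ (K - 1)` is a genuine threshold.
  set K := K₀ + 2 with hKdef
  have hstall : ∀ k, K ≤ k → R.Stalled J τ k ω ∧ τ.stall = StallRule.hold := by
    intro k hk
    have := hK₀ k (by omega)
    rw [Updates, not_or, not_not] at this
    refine ⟨this.1, ?_⟩
    cases hst : τ.stall
    · exact absurd hst this.2
    · rfl
  have hε : τ.ε = 0 := hτ (hstall K le_rfl).2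
  have hθ : ∀ k, K ≤ k → R.θ k ω = R.θ K ω := by
    intro k hk
    induction k, hk using Nat.le_induction with
    | base => rfl
    | succ k hk ih => rw [(hpar k (by omega)).2 (hK₀ k (by omega)), ih]
  have hγc : ∀ k, K ≤ k → R.γ (k - 1) ω = R.γ (K - 1) ω := by
    intro k hk
    induction k, hk using Nat.le_induction with
    | base => rfl
    | succ k hk ih =>
      rw [Nat.add_sub_cancel, ((hthr k (by omega)).2.2.2 (hstall k hk).1).1, ih]
  -- Stalling with `ε = 0` makes every sample cost more than the frozen threshold, hence more than
  -- `q`. For `ε > 0` the bound `γ - ε` could lie below the minimum.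
  obtain ⟨q, hq1, hq2⟩ := exists_rat_btwn (hγ (K - 1) (by omega))
  refine hmissω K (by omega) q hq1 fun k hk => ⟨hθ k hk, fun hmem => ?_⟩
  have hsize := (level_and_size_of_thresholdStep hinit.2.1 hinit.2.2 hthr
    (show 1 ≤ k by omega)).2
  have := (hstall k hk).1.lt_cost (i := 0) (by omega)
  rw [hε, sub_zero, hγc k hk] at this
  exact absurd hmem.2 (by linarith)

/-- Testing against a fixed direction `u` turns both limits into scalar smoothing recursions, whose
inputs are squeezed by the second moment of the target measure. -/
theorem ae_tendsto [NullSingletonClass (volume : Measure (Vec N))]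
    [IsProbabilityMeasure Pr] (hR : R.IsRun J τ Pr ℱ S W Θ θ₀) (h : IsRegularCost J S W w₀)
    (hθ₀ : θ₀ ∈ Θ) (hΘ : ∀ θ ∈ Θ, (covMatrix θ).PosDef)
    (hτ : τ.stall = StallRule.hold → τ.ε = 0)
    (hint : ∀ᵐ ω ∂Pr, ∀ k, 1 ≤ k → R.Updates J τ k ω → R.θopt (k + 1) ω ∈ interior Θ) :
    ∀ᵐ ω ∂Pr, Tendsto (fun k => mean (R.θ k ω)) atTop (𝓝 w₀) ∧
      Tendsto (fun k => covMatrix (R.θ k ω)) atTop (𝓝 0) := by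
  filter_upwards [hR.parameter, hint, hR.ae_threshold_gt h, hR.ae_posDef hθ₀ hΘ,
    hR.ae_frequently_updates h hθ₀ hΘ hτ] with ω hpar hint hγ hpd hfreq
  set U : Set ℕ := {k | R.Updates J τ k ω}
  have key : ∀ u : Fin N → ℝ,
      Tendsto (fun k => u ⬝ᵥ (mean (R.θ k ω) - w₀).ofLp) atTop (𝓝 0) ∧
      Tendsto (fun k => u ⬝ᵥ covMatrix (R.θ k ω) *ᵥ u) atTop (𝓝 0) := by
    intro u
    have hM := (h.tendsto_integral_div_targetMeasure
      (eventually_atTop.2 ⟨1, hγ⟩) ((continuous_dotProduct_sub u w₀).fun_pow 2)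
      (fun _ => sq_nonneg _) (by simp)).mono_left
      (inf_le_left : atTop ⊓ 𝓟 U ≤ atTop)
    have hsum : ∀ᶠ k in atTop ⊓ 𝓟 U, 0 ≤ u ⬝ᵥ covMatrix (R.θopt (k + 1) ω) *ᵥ u ∧
        (u ⬝ᵥ covMatrix (R.θopt (k + 1) ω) *ᵥ u) +
          (u ⬝ᵥ (mean (R.θopt (k + 1) ω) - w₀).ofLp) ^ 2 =
        (∫ w, (u ⬝ᵥ (w - w₀).ofLp) ^ 2 ∂(targetMeasure J S W k (R.γ k ω))) /
          (targetMeasure J S W k (R.γ k ω)).real univ := by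
      rw [eventually_inf_principal]
      filter_upwards [eventually_ge_atTop 1] with k hk hkU
      obtain ⟨⟨hmem, hmax⟩, -⟩ := (hpar k hk).1 hkU
      exact ⟨by simpa using (hΘ _ hmem).posSemidef.dotProduct_mulVec_nonneg u,
        h.second_moment_update_eq (hpd k hk) (hγ k hk) hΘ (hint k hk hkU) hmax u⟩
    have hcov : Tendsto (fun k => u ⬝ᵥ covMatrix (R.θopt (k + 1) ω) *ᵥ u)
        (atTop ⊓ 𝓟 U) (𝓝 0) :=
      tendsto_of_tendsto_of_tendsto_of_le_of_le' tendsto_const_nhds hM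
        (hsum.mono fun k hk => hk.1)
        (hsum.mono fun k hk => by
          rw [← hk.2]
          exact le_add_of_nonneg_right (sq_nonneg _))
    have hmean2 : Tendsto (fun k => (u ⬝ᵥ (mean (R.θopt (k + 1) ω) - w₀).ofLp) ^ 2)
        (atTop ⊓ 𝓟 U) (𝓝 0) :=
      tendsto_of_tendsto_of_tendsto_of_le_of_le' tendsto_const_nhds hM
        (Eventually.of_forall fun k => sq_nonneg _)
        (hsum.mono fun k hk => by
          rw [← hk.2]
          exact le_add_of_nonneg_left hk.1)
    have hmean : Tendsto (fun k => u ⬝ᵥ (mean (R.θopt (k + 1) ω) - w₀).ofLp)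
        (atTop ⊓ 𝓟 U) (𝓝 0) := by
      rw [tendsto_zero_iff_abs_tendsto_zero]
      simpa [Function.comp_def, Real.sqrt_sq_eq_abs] using hmean2.sqrt
    constructor
    · refine tendsto_zero_of_smoothing τ.lam_nonneg τ.lam_lt_one hfreq ?_ ?_ hmean
      · filter_upwards [eventually_ge_atTop 1] with k hk hkU
        have hm : mean (R.θ (k + 1) ω) - w₀ = τ.lam • (mean (R.θ k ω) - w₀) +
            (1 - τ.lam) • (mean (R.θopt (k + 1) ω) - w₀) := by
          rw [((hpar k hk).1 hkU).2]
          simp only [mean, Prod.fst_add, Prod.smul_fst]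
          module
        rw [hm]
        simp only [WithLp.ofLp_add, WithLp.ofLp_smul, dotProduct_add, dotProduct_smul,
          smul_eq_mul]
      · filter_upwards [eventually_ge_atTop 1] with k hk hkU
        rw [(hpar k hk).2 hkU]
    · refine tendsto_zero_of_smoothing τ.lam_nonneg τ.lam_lt_one hfreq ?_ ?_ hcov
      · filter_upwards [eventually_ge_atTop 1] with k hk hkU
        have hc : covMatrix (R.θ (k + 1) ω) = τ.lam • covMatrix (R.θ k ω) +
            (1 - τ.lam) • covMatrix (R.θopt (k + 1) ω) := by
          rw [((hpar k hk).1 hkU).2]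
          rfl
        rw [hc, Matrix.add_mulVec, Matrix.smul_mulVec, Matrix.smul_mulVec, dotProduct_add,
          dotProduct_smul, dotProduct_smul, smul_eq_mul, smul_eq_mul]
      · filter_upwards [eventually_ge_atTop 1] with k hk hkU
        rw [(hpar k hk).2 hkU]
  constructor
  · have hcoord : Tendsto (fun k => (mean (R.θ k ω)).ofLp) atTop (𝓝 w₀.ofLp) := by
      refine tendsto_pi_nhds.2 fun i => ?_
      have := (key (Pi.single i 1)).1
      simp only [single_one_dotProduct, PiLp.sub_apply] at this
      exact tendsto_sub_nhds_zero_iff.1 this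
    exact ((PiLp.continuous_toLp 2 _).tendsto _).comp hcoord
  · refine tendsto_pi_nhds.2 fun i => tendsto_pi_nhds.2 fun j => ?_
    -- Polarization recovers the entries of the symmetric matrix from its quadratic form.
    have hlim := ((((key (Pi.single i 1 + Pi.single j 1)).2.sub (key (Pi.single i 1)).2).sub
      (key (Pi.single j 1)).2).div_const 2)
    simp only [sub_zero, zero_div] at hlim
    refine hlim.congr fun k => ?_
    have hsymm : covMatrix (R.θ k ω) j i = covMatrix (R.θ k ω) i j := by
      have := congrFun (congrFun (R.θ k ω).2.2 i) j
      simpa [covMatrix, Matrix.star_apply] using this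
    simp only [Matrix.mulVec_add, dotProduct_add, add_dotProduct, Matrix.mulVec_single_one,
      single_one_dotProduct, Matrix.col_apply, hsymm]
    ring

end PlannerRun.IsRun

theorem isRegularCost_of_separated {N : ℕ} {J : Vec N → ℝ} {S : ℝ → ℝ} {W : Set (Vec N)}
    {w₀ : Vec N} (hW : IsCompact W) (hmeas : Measurable (W.domRestrict J)) (hmem : w₀ ∈ W)
    (hle : ∀ w ∈ W, J w₀ ≤ J w)
    (hpos : ∀ ξ : ℝ, ξ < -J w₀ → 0 < volume {w ∈ W | ξ ≤ -J w})
    (hsep : ∀ δ : ℝ, 0 < δ →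
      (⨆ w ∈ {w ∈ W | δ ≤ ‖w - w₀‖}, ((-J w : ℝ) : EReal)) < ((-J w₀ : ℝ) : EReal))
    (hS : StrictAntiOn S (J '' W)) (hSpos : ∀ c ∈ J '' W, 0 < S c) :
    IsRegularCost J S W w₀ where
  isCompact := hW
  measurable := hmeas
  mem := hmem
  le := hle
  volume_sublevel_pos c hc := by
    have := hpos (-c) (neg_lt_neg hc)
    simpa only [neg_le_neg_iff] using this
  gap δ hδ := by
    -- A real `x` above the supremum exists even when no point is far and the supremum is `⊥`.
    obtain ⟨x, hx1, hx2⟩ := EReal.lt_iff_exists_real_btwn.1 (hsep δ hδ)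
    rw [EReal.coe_lt_coe_iff] at hx2
    refine ⟨-J w₀ - x, by linarith, fun w hw hfar => ?_⟩
    have h1 : ((-J w : ℝ) : EReal) ≤ ⨆ w ∈ {w ∈ W | δ ≤ ‖w - w₀‖}, ((-J w : ℝ) : EReal) :=
      le_iSup₂ (f := fun w (_ : w ∈ {w ∈ W | δ ≤ ‖w - w₀‖}) => ((-J w : ℝ) : EReal)) w
        ⟨hw, hfar⟩
    have h2 := EReal.coe_lt_coe_iff.1 (h1.trans_lt hx1)
    linarith
  strictAnti := hS
  pos := hSpos

end MRASPlanner

end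

theorem mainTheorem2 {n m N : ℕ}
    -- the control problem, the basis functions and the weight domain
    (P : MRASPlanner.ControlProblem n m)
    (φ : Fin N → MRASPlanner.Vec n → MRASPlanner.Vec m)
    (W : Set (MRASPlanner.Vec N)) (hW : IsCompact W)
    (hpolicy : ∀ w ∈ W, MRASPlanner.ControlProblem.policy φ w ∈ P.policies)
    (hwell : ∀ w ∈ W, P.WellPosed (MRASPlanner.ControlProblem.policy φ w))
    (hmeas : Measurable (W.domRestrict (P.weightCost φ)))
    -- the optimal weight vector and the first two regularity conditions, with `H = -J(x₀; ·)`
    (wstar : MRASPlanner.Vec N) (hopt : P.IsOptimalWeight φ W wstar)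
    (hA1 : ∀ ξ : ℝ, ξ < -P.weightCost φ wstar →
      0 < MeasureTheory.volume {w ∈ W | ξ ≤ -P.weightCost φ w})
    (hA2 : ∀ δ : ℝ, 0 < δ →
      (⨆ w ∈ {w ∈ W | δ ≤ ‖w - wstar‖}, ((-P.weightCost φ w : ℝ) : EReal)) <
        ((-P.weightCost φ wstar : ℝ) : EReal))
    -- the weighting function, strictly decreasing and positive on the attained costs
    (S : ℝ → ℝ) (hS : StrictAntiOn S (P.weightCost φ '' W))
    (hSpos : ∀ c ∈ P.weightCost φ '' W, 0 < S c)
    -- the parameter set and the tuning parameters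
    (Θ : Set (MRASPlanner.Param N)) (hΘ : ∀ θ ∈ Θ, (MRASPlanner.covMatrix θ).PosDef)
    (θ₀ : MRASPlanner.Param N) (hθ₀ : θ₀ ∈ Θ)
    (τ : MRASPlanner.Tuning) (hτ : τ.stall = MRASPlanner.StallRule.hold → τ.ε = 0)
    -- a run of the planner
    {Ω : Type*} [mΩ : MeasurableSpace Ω] (Pr : MeasureTheory.Measure Ω)
    [MeasureTheory.IsProbabilityMeasure Pr] (ℱ : MeasureTheory.Filtration ℕ mΩ)
    (R : MRASPlanner.PlannerRun Ω N)
    (hR : R.IsRun (P.weightCost φ) τ Pr ℱ S W Θ θ₀)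
    -- the third regularity condition
    (hA3 : ∀ᵐ ω ∂Pr, ∀ k, 1 ≤ k → R.Updates (P.weightCost φ) τ k ω →
      R.θopt (k + 1) ω ∈ interior Θ) :
    ∀ᵐ ω ∂Pr,
      Filter.Tendsto (fun k => MRASPlanner.mean (R.θ k ω)) Filter.atTop (nhds wstar) ∧
      Filter.Tendsto (fun k => MRASPlanner.covMatrix (R.θ k ω)) Filter.atTop (nhds 0) := by
  -- In dimension zero singletons are not Lebesgue null, but all means and all matrices coincide.
  rcases Nat.eq_zero_or_pos N with rfl | hN
  · refine Filter.Eventually.of_forall fun ω => ⟨?_, ?_⟩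
    · exact tendsto_const_nhds.congr fun k => Subsingleton.elim _ _
    · exact tendsto_const_nhds.congr fun k => Subsingleton.elim _ _
  · have : Nonempty (Fin N) := ⟨⟨0, hN⟩⟩
    have hreg := MRASPlanner.isRegularCost_of_separated hW hmeas hopt.1
      (fun w hw => hopt.2.2 w hw (hpolicy w hw)) hA1 hA2 hS hSpos
    exact hR.ae_tendsto hreg hθ₀ hΘ hτ hA3
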